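/- **Setting.** An instance $\mathcal I=(\Omega,A,u,v,\mu^*)$ consists of a finite set $\Omega$ of states, a finite set $A$ of actions, utilities $u,v:A\times\Omega\to[0,1]$ of the designer and the receiver, and a prior $\mu^*\in\Delta(\Omega)$. A signaling scheme $\pi$ sends, in state $\omega$, a signal $s$ from a finite set with probability $\pi(s\mid\omega)$. On seeing $s$, the receiver, who knows $\mu^*$ and $\pi$, takes an action $a_{s,\pi}\in\arg\max_{a}\sum_\omega\mu^*(\omega)\pi(s\mid\omega)v(a,\omega)$, with ties broken by an arbitrary (measurable) rule. Put $U(\mu^*,\pi)=\sum_\omega\mu^*(\omega)\sum_s\pi(s\mid\omega)u(a_{s,\pi},\omega)$ and $U^*=\sup_\pi U(\mu^*,\pi)$. In each of $T$ periods the designer, who knows $\Omega,A,u,v,T$ but not $\mu^*$, announces a scheme $\pi^{(t)}$ chosen by a (possibly randomized) learning algorithm from the past schemes, signals, actions and (if she observes them) states; then $\omega^{(t)}\sim\mu^*$ is drawn independently, $s^{(t)}\sim\pi^{(t)}(\cdot\mid\omega^{(t)})$ is drawn, and the receiver takes the action $a^{(t)}=a_{s^{(t)},\pi^{(t)}}$.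 The regret is $\mathrm{Reg}(T;\mathcal I)=T\cdot U^*-\mathbb E\big[\sum_{t=1}^T u(a^{(t)},\omega^{(t)})\big]$. For $\varepsilon\in(0,\tfrac14]$ and $p\in[0.1,0.3]$ let $\mathcal I_{\varepsilon,p}$ be the instance with states $\{0,1\}$, prior probability $p$ of state $1$, actions $\{a,b,c\}$, receiver utilities $v(a,0)=v(b,1)=1$, $v(a,1)=v(b,0)=0$, $v(c,0)=v(c,1)=\tfrac12+\varepsilon$, and designer utilities $u(c,\cdot)=1$, $u(a,\cdot)=u(b,\cdot)=0$. **Theorem.** There is an absolute constant $c>0$ such that the following hold. 1. For every $T\ge1$ there is $\varepsilon\in(0,\tfrac14]$ such that for every tie-breaking rule and every learning algorithm of the designer there is $p\in[0.1,0.3]$ with $$\mathrm{Reg}(T;\mathcal I_{\varepsilon,p})\ \ge\ c\log T .$$ In particular, for any learning algorithm there is an instance, with two states and three actions, on which the regret is $\Omega(\log T)$. 2. There is $T_0$ such that for every $T\ge T_0$, every tie-breaking rule and every learning algorithm, with $\kappa=T^{-3/2}$ and $p$ drawn uniformly from the grid $\Gamma=\{0.1+i\kappa: i=0,1,2,\dots\}\cap[0.1,0.3]$,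 $$\mathbb E_{p\sim\mathrm{Unif}(\Gamma)}\big[\mathrm{Reg}(T;\mathcal I_{\kappa/4,\,p})\big]\ \ge\ c\log T .$$ -/

import Mathlib

namespace Persuasion

universe w

/-- An instance of the information design problem with finite state space `Ω` and action set `A`:
the designer's utility `u` and the receiver's utility `v`, both with values in `[0, 1]`, and the
prior `prior`, a probability distribution on `Ω`. -/
structure Instance (Ω A : Type*) [Fintype Ω] where
  u : A → Ω → ℝ
  v : A → Ω → ℝ
  u_mem : ∀ a ω, u a ω ∈ Set.Icc (0 : ℝ) 1
  v_mem : ∀ a ω, v a ω ∈ Set.Icc (0 : ℝ) 1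
  prior : Ω → ℝ
  prior_mem : prior ∈ stdSimplex ℝ Ω

/-- A signaling scheme with finitely many signals: in state `ω` the signal `s` is sent with
probability `prob ω s`. Signals are labelled by natural numbers, and only finitely many labels are
used, so that every finite signal set is covered. -/
structure Scheme (Ω : Type*) where
  prob : Ω → ℕ →₀ ℝ
  nonneg : ∀ ω s, 0 ≤ prob ω s
  sum_eq_one : ∀ ω, ((prob ω).sum fun _ p => p) = 1

/-- The σ-algebra on signaling schemes generated by the probabilities `π(s | ω)`. -/
instance (Ω : Type*) : MeasurableSpace (Scheme Ω) :=
  MeasurableSpace.comap (fun (π : Scheme Ω) (ω : Ω) (s : ℕ) => π.prob ω s) MeasurableSpace.pi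

section Model

variable {Ω A : Type*} [Fintype Ω]

/-- The receiver's expected utility from action `a` at the posterior induced by the signal `s`,
multiplied by the probability of `s`: `∑ ω, μ(ω) π(s | ω) v(a, ω)`. -/
def receiverValue (I : Instance Ω A) (π : Scheme Ω) (s : ℕ) (a : A) : ℝ :=
  ∑ ω, I.prior ω * π.prob ω s * I.v a ω

/-- A best-response rule of the receiver, who knows the instance (in particular the prior), the
signaling scheme and the signal. Ties are broken in an arbitrary (measurable) way. -/
structure BestResponse (Ω A : Type*) [Fintype Ω] where
  act : Instance Ω A → Scheme Ω → ℕ → A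
  optimal : ∀ I π s a, receiverValue I π s a ≤ receiverValue I π s (act I π s)
  measurableSet_act : ∀ I s a, MeasurableSet {π : Scheme Ω | act I π s = a}

/-- The designer's expected utility `U(μ, π)` in a single period. -/
def utility (R : BestResponse Ω A) (I : Instance Ω A) (π : Scheme Ω) : ℝ :=
  ∑ ω, I.prior ω * (π.prob ω).sum fun s p => p * I.u (R.act I π s) ω

/-- The designer's optimal single-period utility `U*` for a known prior. -/
noncomputable def optimalUtility (R : BestResponse Ω A) (I : Instance Ω A) : ℝ :=
  ⨆ π : Scheme Ω, utility R I π

/-- What has been observed so far: the triples (state, signal, action) of the past periods, the most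
recent one first. -/
abbrev History (Ω A : Type*) := List (Ω × ℕ × A)

/-- A possibly randomized learning algorithm of the designer: given the random seed `θ`, drawn once
from the distribution `law`, and the history `h`, the scheme `choose θ h` is announced next. The past
schemes are determined by the seed and the history. The algorithm may use the realized past states;
one that does not observe them is the special case in which `choose` ignores them. -/
structure LearningAlgorithm (Ω A : Type*) where
  Seed : Type w
  [measurableSpace : MeasurableSpace Seed]
  law : MeasureTheory.Measure Seed
  [isProbabilityMeasure : MeasureTheory.IsProbabilityMeasure law]
  choose : Seed → History Ω A → Scheme Ω
  measurable_choose : ∀ h, Measurable fun θ => choose θ h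

/-- The expected sum of the designer's utilities `u(a, ω)` over the next `n` periods after the
history `h`, when the schemes are chosen by `σ`. In each period a fresh state `ω` is drawn from the
prior, then a signal `s` from `π(· | ω)`, and the receiver best responds. -/
def totalUtility (R : BestResponse Ω A) (I : Instance Ω A) (σ : History Ω A → Scheme Ω) :
    ℕ → History Ω A → ℝ
  | 0, _ => 0
  | n + 1, h => ∑ ω, I.prior ω * ((σ h).prob ω).sum fun s p =>
      p * (I.u (R.act I (σ h) s) ω + totalUtility R I σ n ((ω, s, R.act I (σ h) s) :: h))

/-- The regret over `T` periods: `T · U*` minus the expected total utility of the designer, where the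
expectation is also over the randomness of the algorithm. -/
noncomputable def regret (R : BestResponse Ω A) (I : Instance Ω A)
    (alg : LearningAlgorithm.{w} Ω A) (T : ℕ) : ℝ :=
  letI := alg.measurableSpace
  T * optimalUtility R I - ∫ θ, totalUtility R I (alg.choose θ) T [] ∂alg.law

end Model

/-- The two-state, three-action instance with tolerance `ε` in which state `1` has prior probability
`p`. Actions `0, 1, 2` stand for `a, b, c`: the receiver gets `1` from `a` in state `0` and from `b`
in state `1`, gets `1/2 + ε` from `c` in both states, and `0` otherwise; thus `c` is optimal exactly
at posteriors in `[1/2 - ε, 1/2 + ε]`. The designer gets `1` from `c` and `0` from `a` and `b`. -/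
noncomputable def hardInstance (ε p : ℝ) (hε : ε ∈ Set.Icc (0 : ℝ) (1 / 4))
    (hp : p ∈ Set.Icc (1 / 10 : ℝ) (3 / 10)) : Instance (Fin 2) (Fin 3) where
  u a _ := ![0, 0, 1] a
  v a ω := ![![1, 0], ![0, 1], ![1 / 2 + ε, 1 / 2 + ε]] a ω
  u_mem a ω := by fin_cases a <;> simp
  v_mem a ω := by
    obtain ⟨h0, h1⟩ := hε
    fin_cases a <;> fin_cases ω <;> simp <;> constructor <;> linarith
  prior := ![1 - p, p]
  prior_mem := by
    obtain ⟨h0, h1⟩ := hp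
    constructor
    · intro ω
      fin_cases ω <;> simp <;> linarith
    · simp

/-- The grid step `κ = T ^ (-3/2)`. -/
noncomputable def gridStep (T : ℕ) : ℝ := (T : ℝ) ^ (-(3 / 2) : ℝ)

/-- The largest `k` with `1/10 + k κ ≤ 3/10`. -/
noncomputable def gridSize (T : ℕ) : ℕ := ⌊(1 / 5) / gridStep T⌋₊

/-- The grid points `1/10, 1/10 + κ, 1/10 + 2 κ, …` in `[1/10, 3/10]`. -/
noncomputable def gridPoint (T : ℕ) (i : Fin (gridSize T + 1)) : ℝ := 1 / 10 + i * gridStep T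

theorem gridStep_nonneg (T : ℕ) : 0 ≤ gridStep T := Real.rpow_nonneg (Nat.cast_nonneg T) _

theorem gridStep_div_mem (T : ℕ) : gridStep T / 4 ∈ Set.Icc (0 : ℝ) (1 / 4) := by
  have h0 := gridStep_nonneg T
  have h1 : gridStep T ≤ 1 := by
    unfold gridStep
    rcases Nat.eq_zero_or_pos T with rfl | hT
    · rw [Nat.cast_zero, Real.zero_rpow (by norm_num)]
      exact zero_le_one
    · exact Real.rpow_le_one_of_one_le_of_nonpos (by exact_mod_cast hT) (by norm_num)
  constructor <;> linarith

theorem gridPoint_mem (T : ℕ) (i : Fin (gridSize T + 1)) :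
    gridPoint T i ∈ Set.Icc (1 / 10 : ℝ) (3 / 10) := by
  have h0 := gridStep_nonneg T
  have hi : (i : ℝ) ≤ (gridSize T : ℝ) := by exact_mod_cast Nat.lt_succ_iff.mp i.2
  have h1 : (gridSize T : ℝ) ≤ (1 / 5) / gridStep T := Nat.floor_le (by positivity)
  have h2 : (i : ℝ) * gridStep T ≤ 1 / 5 := by
    rcases h0.eq_or_lt with h | h
    · rw [← h]; norm_num
    · exact (le_div_iff₀ h).mp (hi.trans h1)
  have h3 : 0 ≤ (i : ℝ) * gridStep T := by positivity
  unfold gridPoint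
  constructor <;> linarith

/-- The hard instance for horizon `T` with the `i`-th grid point as prior, and with tolerance `κ / 4`. -/
noncomputable def gridInstance (T : ℕ) (i : Fin (gridSize T + 1)) : Instance (Fin 2) (Fin 3) :=
  hardInstance (gridStep T / 4) (gridPoint T i) (gridStep_div_mem T) (gridPoint_mem T i)

end Persuasion

open Finset Filter MeasureTheory

namespace Persuasion

/-! With a tiny tolerance, a signal makes `c` optimal only for priors in a tiny window. Over a
family of priors spaced `4 * ε` apart, each signal therefore earns utility at no more than one of
them (`prob_eq_zero_of_act_eq_two`), so a period earns at most `|Ω|` summed over the family,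
whatever the scheme.

Learning does not help quickly: given the state, the signal has the same law under every prior, so
only the state and the action distinguish instances. At most `(|Ω| |A|) ^ m` branches arise in `m`
periods, and the earnings of the whole family in those periods are at most `8 ^ m`
(`Conflicting.sum_mul_totalUtility_le`). A known prior earns at least `1/5` per period, so `N`
priors have total regret at least `N * m / 5 - 8 ^ m` (`le_sum_regret_hardInstance`). Taking `m = T`
and `N = 10 * 8 ^ T` gives even linear regret for one prior; on the grid, `m ≈ log₈ T` gives the
logarithmic average. -/

theorem sum_prob {Ω : Type*} (π : Scheme Ω) (ω : Ω) : ∑ s ∈ (π.prob ω).support, π.prob ω s = 1 :=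
  π.sum_eq_one ω

theorem measurable_prob {Ω : Type*} (ω : Ω) (s : ℕ) : Measurable fun π : Scheme Ω => π.prob ω s := by
  have h : Measurable fun (π : Scheme Ω) (ω : Ω) (s : ℕ) => π.prob ω s :=
    comap_measurable _
  exact (measurable_pi_apply s).comp ((measurable_pi_apply ω).comp h)

theorem measurable_finsupp_sum_mul {X : Type*} [MeasurableSpace X] (f : X → ℕ →₀ ℝ)
    (g : X → ℕ → ℝ) (hf : ∀ s, Measurable fun x => f x s) (hg : ∀ s, Measurable fun x => g x s) :
    Measurable fun x => (f x).sum fun s p => p * g x s := by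
  -- The support varies with `x`, so the sum is taken as a limit of sums over fixed ranges.
  refine measurable_of_tendsto_metrizable
    (f := fun n x => ∑ s ∈ range n, f x s * g x s)
    (fun n => Finset.measurable_fun_sum _ fun s _ => (hf s).mul (hg s)) ?_
  refine tendsto_pi_nhds.2 fun x => ?_
  exact (hasSum_sum_of_ne_finset_zero fun s hs => by
    rw [Finsupp.notMem_support_iff.1 hs, zero_mul]).tendsto_sum_nat

/-! ### Utilities in a general instance: bounds and measurability. -/

section General

variable {Ω A : Type*} [Fintype Ω]

theorem sum_prior (I : Instance Ω A) : ∑ ω, I.prior ω = 1 := I.prior_mem.2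

theorem prior_nonneg (I : Instance Ω A) (ω : Ω) : 0 ≤ I.prior ω := I.prior_mem.1 ω

theorem prior_le_one (I : Instance Ω A) (ω : Ω) : I.prior ω ≤ 1 :=
  (Finset.single_le_sum (fun i _ => prior_nonneg I i) (mem_univ ω)).trans (sum_prior I).le

theorem sum_prior_mul_sum_prob (I : Instance Ω A) (π : Scheme Ω) (r : ℝ) :
    ∑ ω, I.prior ω * ∑ s ∈ (π.prob ω).support, π.prob ω s * r = r := by
  simp [← Finset.sum_mul, sum_prob, sum_prior]

theorem utility_le_one (R : BestResponse Ω A) (I : Instance Ω A) (π : Scheme Ω) :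
    utility R I π ≤ 1 := by
  rw [← sum_prior_mul_sum_prob I π 1]
  refine sum_le_sum fun ω _ => mul_le_mul_of_nonneg_left ?_ (prior_nonneg I ω)
  exact sum_le_sum fun s _ => mul_le_mul_of_nonneg_left (I.u_mem _ _).2 (π.nonneg ω s)

theorem utility_le_optimalUtility (R : BestResponse Ω A) (I : Instance Ω A) (π : Scheme Ω) :
    utility R I π ≤ optimalUtility R I :=
  le_ciSup (f := fun π => utility R I π) ⟨1, by rintro _ ⟨π, rfl⟩; exact utility_le_one R I π⟩ π

/-- The expected total utility splits into the utility of the current period and the expected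
continuation. -/
theorem totalUtility_succ (R : BestResponse Ω A) (I : Instance Ω A) (σ : History Ω A → Scheme Ω)
    (n : ℕ) (h : History Ω A) :
    totalUtility R I σ (n + 1) h = utility R I (σ h) +
      ∑ ω, I.prior ω * ∑ s ∈ ((σ h).prob ω).support,
        (σ h).prob ω s * totalUtility R I σ n ((ω, s, R.act I (σ h) s) :: h) := by
  simp only [totalUtility, utility, Finsupp.sum, mul_add, sum_add_distrib]

theorem totalUtility_nonneg (R : BestResponse Ω A) (I : Instance Ω A)
    (σ : History Ω A → Scheme Ω) (n : ℕ) (h : History Ω A) : 0 ≤ totalUtility R I σ n h := by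
  induction n generalizing h with
  | zero => exact le_rfl
  | succ n ih =>
    refine sum_nonneg fun ω _ => mul_nonneg (prior_nonneg I ω) (sum_nonneg fun s _ => ?_)
    exact mul_nonneg ((σ h).nonneg ω s) (add_nonneg (I.u_mem _ _).1 (ih _))

theorem totalUtility_le_mul (R : BestResponse Ω A) (I : Instance Ω A)
    (σ : History Ω A → Scheme Ω) {r : ℝ} (hr : ∀ π, utility R I π ≤ r) (n : ℕ)
    (h : History Ω A) : totalUtility R I σ n h ≤ n * r := by
  induction n generalizing h with
  | zero => simp [totalUtility]
  | succ n ih =>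
    rw [totalUtility_succ, Nat.cast_succ, add_one_mul, add_comm]
    refine add_le_add ?_ (hr _)
    rw [← sum_prior_mul_sum_prob I (σ h) (n * r)]
    refine sum_le_sum fun ω _ => mul_le_mul_of_nonneg_left ?_ (prior_nonneg I ω)
    exact sum_le_sum fun s _ => mul_le_mul_of_nonneg_left (ih _) ((σ h).nonneg ω s)

theorem measurable_totalUtility [Fintype A] (R : BestResponse Ω A) (I : Instance Ω A)
    {X : Type*} [MeasurableSpace X] (σ : X → History Ω A → Scheme Ω)
    (hσ : ∀ h, Measurable fun x => σ x h) (n : ℕ) (h : History Ω A) :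
    Measurable fun x => totalUtility R I (σ x) n h := by
  classical
  induction n generalizing h with
  | zero => exact measurable_const
  | succ n ih =>
    refine Finset.measurable_fun_sum _ fun ω _ => Measurable.const_mul ?_ _
    refine measurable_finsupp_sum_mul _
      (fun x s => I.u (R.act I (σ x h) s) ω +
        totalUtility R I (σ x) n ((ω, s, R.act I (σ x h) s) :: h))
      (fun s => (measurable_prob ω s).comp (hσ h)) fun s => ?_
    -- The next history depends on `x` only through the action, so splitting over the finitely many
    -- actions reduces to fixed histories.
    have key : (fun x => I.u (R.act I (σ x h) s) ω +
        totalUtility R I (σ x) n ((ω, s, R.act I (σ x h) s) :: h)) = fun x =>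
        ∑ a, if R.act I (σ x h) s = a then
          I.u a ω + totalUtility R I (σ x) n ((ω, s, a) :: h) else 0 := by
      funext x
      simp
    rw [key]
    exact Finset.measurable_fun_sum _ fun a _ => Measurable.ite
      (hσ h (R.measurableSet_act I s a)) ((ih _).const_add _) measurable_const

theorem integrable_totalUtility [Fintype A] (R : BestResponse Ω A) (I : Instance Ω A)
    {X : Type*} [MeasurableSpace X] (μ : Measure X) [IsProbabilityMeasure μ]
    (σ : X → History Ω A → Scheme Ω) (hσ : ∀ h, Measurable fun x => σ x h) (n : ℕ)
    (h : History Ω A) : Integrable (fun x => totalUtility R I (σ x) n h) μ := by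
  refine Integrable.of_bound (measurable_totalUtility R I σ hσ n h).aestronglyMeasurable
    (n * 1) (ae_of_all _ fun x => ?_)
  rw [Real.norm_of_nonneg (totalUtility_nonneg R I _ n h)]
  exact totalUtility_le_mul R I _ (utility_le_one R I) n h

/-! ### Regret summed over a conflicting family. -/

/-- A family of instances in which no signal earns the designer a utility exceeding `1` in total
over the family. -/
def Conflicting {ι : Type*} [Fintype ι] (R : BestResponse Ω A) (I : ι → Instance Ω A) : Prop :=
  ∀ (π : Scheme Ω) (ω : Ω) (s : ℕ), π.prob ω s ≠ 0 → ∑ i, (I i).u (R.act (I i) π s) ω ≤ 1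

variable {ι : Type*} [Fintype ι]

/-- Bounding the priors by `1` leaves the weights `π(s | ω)`, common to all instances, so each state
contributes at most `1`. -/
theorem Conflicting.sum_utility_le {R : BestResponse Ω A} {I : ι → Instance Ω A}
    (hI : Conflicting R I) (π : Scheme Ω) : ∑ i, utility R (I i) π ≤ Fintype.card Ω := by
  have h1 : ∀ i, utility R (I i) π ≤
      ∑ ω, ∑ s ∈ (π.prob ω).support, π.prob ω s * (I i).u (R.act (I i) π s) ω := fun i =>
    sum_le_sum fun ω _ => mul_le_of_le_one_left
      (sum_nonneg fun s _ => mul_nonneg (π.nonneg ω s) ((I i).u_mem _ _).1) (prior_le_one _ ω)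
  refine (sum_le_sum fun i _ => h1 i).trans ?_
  rw [sum_comm, Fintype.card, card_eq_sum_ones, Nat.cast_sum, Nat.cast_one]
  refine sum_le_sum fun ω _ => ?_
  rw [sum_comm, ← sum_prob π ω]
  refine sum_le_sum fun s hs => ?_
  rw [← mul_sum]
  exact mul_le_of_le_one_right (π.nonneg ω s) (hI π ω s (Finsupp.mem_support_iff.1 hs))

/-- In the first `m` periods there are at most `(|Ω| |A|) ^ m` essentially different observations,
and each of them leads to a utility of at most `|Ω|` over the whole family. The weights `l` stand
for the likelihoods of the history. -/
theorem Conflicting.sum_mul_totalUtility_le [Fintype A] [Nonempty Ω] {R : BestResponse Ω A}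
    {I : ι → Instance Ω A} (hI : Conflicting R I) (σ : History Ω A → Scheme Ω) (n m : ℕ)
    (h : History Ω A) (l : ι → ℝ) (hl : ∀ i, l i ∈ Set.Icc (0 : ℝ) 1) :
    ∑ i, l i * totalUtility R (I i) σ (n + m) h ≤
      n * ∑ i, l i * optimalUtility R (I i) +
        ((Fintype.card Ω : ℝ) * (Fintype.card A + 1)) ^ m := by
  classical
  induction m generalizing h l with
  | zero =>
    rw [pow_zero, mul_sum]
    refine le_add_of_le_of_nonneg (sum_le_sum fun i _ => ?_) zero_le_one
    rw [mul_left_comm]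
    exact mul_le_mul_of_nonneg_left
      (totalUtility_le_mul R _ σ (utility_le_optimalUtility R _) n h) (hl i).1
  | succ m ih =>
    set B := ((Fintype.card Ω : ℝ) * (Fintype.card A + 1)) ^ m with hB
    have hΩ : (1 : ℝ) ≤ Fintype.card Ω := by exact_mod_cast Fintype.card_pos
    have hB1 : 1 ≤ B := one_le_pow₀ (by
      have : (0 : ℝ) ≤ Fintype.card A := Nat.cast_nonneg _
      nlinarith)
    have h1 : ∑ i, l i * utility R (I i) (σ h) ≤ Fintype.card Ω := by
      refine (sum_le_sum fun i _ => ?_).trans (hI.sum_utility_le (σ h))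
      refine mul_le_of_le_one_left ?_ (hl i).2
      exact sum_nonneg fun ω _ => mul_nonneg (prior_nonneg _ ω)
        (sum_nonneg fun s _ => mul_nonneg ((σ h).nonneg ω s) ((I i).u_mem _ _).1)
    -- The updated likelihood omits `π(s | ω)`: this factor is the same for all `i` and is pulled
    -- out in `hswap`. Signals are thus averaged over rather than counted, and only states and
    -- actions cause branching.
    let w (ω : Ω) (s : ℕ) (a : A) (i : ι) : ℝ :=
      if R.act (I i) (σ h) s = a then l i * (I i).prior ω else 0
    have hw : ∀ ω s a i, w ω s a i ∈ Set.Icc (0 : ℝ) 1 := fun ω s a i => by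
      simp only [w]
      split_ifs
      · exact ⟨mul_nonneg (hl i).1 (prior_nonneg _ ω),
          mul_le_one₀ (hl i).2 (prior_nonneg _ ω) (prior_le_one _ ω)⟩
      · exact ⟨le_rfl, zero_le_one⟩
    have hswap : ∀ f : Ω → ℕ → A → ι → ℝ,
        ∑ i, l i * ∑ ω, (I i).prior ω * ∑ s ∈ ((σ h).prob ω).support,
          (σ h).prob ω s * f ω s (R.act (I i) (σ h) s) i =
        ∑ ω, ∑ s ∈ ((σ h).prob ω).support, (σ h).prob ω s * ∑ a, ∑ i, w ω s a i * f ω s a i := by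
      intro f
      simp_rw [mul_sum]
      rw [sum_comm]
      refine sum_congr rfl fun ω _ => ?_
      rw [sum_comm]
      refine sum_congr rfl fun s _ => ?_
      rw [sum_comm]
      refine sum_congr rfl fun i _ => ?_
      simp only [w, ite_mul, zero_mul, mul_ite, mul_zero, sum_ite_eq, mem_univ, if_true]
      ring
    have h2 : ∑ i, l i * ∑ ω, (I i).prior ω * ∑ s ∈ ((σ h).prob ω).support, (σ h).prob ω s *
          totalUtility R (I i) σ (n + m) ((ω, s, R.act (I i) (σ h) s) :: h) ≤
        n * ∑ i, l i * optimalUtility R (I i) + Fintype.card Ω * (Fintype.card A * B) := by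
      rw [hswap fun ω s a i => totalUtility R (I i) σ (n + m) ((ω, s, a) :: h)]
      calc _ ≤ ∑ ω, ∑ s ∈ ((σ h).prob ω).support, (σ h).prob ω s *
            ∑ a, (n * ∑ i, w ω s a i * optimalUtility R (I i) + B) := by
            refine sum_le_sum fun ω _ => sum_le_sum fun s _ =>
              mul_le_mul_of_nonneg_left (sum_le_sum fun a _ => ?_) ((σ h).nonneg ω s)
            exact ih _ _ (hw ω s a)
        _ = n * ∑ ω, ∑ s ∈ ((σ h).prob ω).support, (σ h).prob ω s *
              ∑ a, ∑ i, w ω s a i * optimalUtility R (I i) +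
            ∑ ω, ∑ s ∈ ((σ h).prob ω).support, (σ h).prob ω s * (Fintype.card A * B) := by
            simp only [sum_add_distrib, mul_add, sum_const, card_univ, nsmul_eq_mul, ← mul_sum]
            congr 1
            rw [mul_sum]
            refine sum_congr rfl fun ω _ => ?_
            rw [mul_sum]
            exact sum_congr rfl fun s _ => by ring
        _ = _ := by
            rw [← hswap fun _ _ _ i => optimalUtility R (I i)]
            simp only [sum_prior_mul_sum_prob]
            simp [← sum_mul, sum_prob]
    rw [← add_assoc]
    rw [pow_succ, ← hB]
    -- The current period costs `|Ω|` and the branches `|Ω| |A| B`; absorbing the former explains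
    -- the base `|Ω| (|A| + 1)`.
    have h3 : (Fintype.card Ω : ℝ) ≤ Fintype.card Ω * B := le_mul_of_one_le_right (by linarith) hB1
    calc _ = _ := by simp only [totalUtility_succ, mul_add (l _), sum_add_distrib]
      _ ≤ _ := add_le_add h1 h2
      _ ≤ _ := by linarith

/-- If every instance of a conflicting family has optimal utility at least `r`, then the regrets
over the family sum to at least `r` times the number of instances for each of the first `m`
periods, up to an error which is exponential in `m`. -/
theorem Conflicting.le_sum_regret [Fintype A] [Nonempty Ω] {R : BestResponse Ω A}
    {I : ι → Instance Ω A} (hI : Conflicting R I) (alg : LearningAlgorithm Ω A) {m T : ℕ}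
    (hm : m ≤ T) {r : ℝ} (hr : ∀ i, r ≤ optimalUtility R (I i)) :
    Fintype.card ι * (m * r) - ((Fintype.card Ω : ℝ) * (Fintype.card A + 1)) ^ m ≤
      ∑ i, regret R (I i) alg T := by
  obtain ⟨n, rfl⟩ := Nat.exists_eq_add_of_le' hm
  let _ := alg.measurableSpace
  have := alg.isProbabilityMeasure
  have hint : ∀ i, Integrable (fun θ => totalUtility R (I i) (alg.choose θ) (n + m) []) alg.law :=
    fun i => integrable_totalUtility R (I i) alg.law _ alg.measurable_choose _ _
  have h1 : ∑ i, ∫ θ, totalUtility R (I i) (alg.choose θ) (n + m) [] ∂alg.law ≤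
      n * ∑ i, optimalUtility R (I i) +
        ((Fintype.card Ω : ℝ) * (Fintype.card A + 1)) ^ m := by
    rw [← integral_finsetSum _ fun i _ => hint i]
    refine (integral_mono (integrable_finsetSum _ fun i _ => hint i)
      (integrable_const _) fun θ => ?_).trans (by simp; rfl)
    simpa using hI.sum_mul_totalUtility_le (alg.choose θ) n m [] (fun _ => 1) (by simp)
  have h2 : Fintype.card ι * r ≤ ∑ i, optimalUtility R (I i) := by
    rw [← nsmul_eq_mul]
    exact card_nsmul_le_sum _ _ _ fun i _ => hr i
  simp only [regret, sum_sub_distrib, ← mul_sum]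
  push_cast
  nlinarith [Nat.cast_nonneg (α := ℝ) m]

end General

/-! ### The hard instances: value of the optimum and conflict of separated priors. -/

section HardInstance

variable {ε p : ℝ} (hε : ε ∈ Set.Icc (0 : ℝ) (1 / 4)) (hp : p ∈ Set.Icc (1 / 10 : ℝ) (3 / 10))

theorem receiverValue_hardInstance (π : Scheme (Fin 2)) (s : ℕ) (a : Fin 3) :
    receiverValue (hardInstance ε p hε hp) π s a =
      ![(1 - p) * π.prob 0 s, p * π.prob 1 s,
        (1 / 2 + ε) * ((1 - p) * π.prob 0 s + p * π.prob 1 s)] a := by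
  fin_cases a <;> simp [receiverValue, hardInstance]
  ring

/-- Signalling state `1` truthfully, pooled with an equal mass of state `0`. -/
noncomputable def poolingScheme (p : ℝ) (hp : p ∈ Set.Icc (1 / 10 : ℝ) (3 / 10)) :
    Scheme (Fin 2) where
  prob := ![Finsupp.single 0 (p / (1 - p)) + Finsupp.single 1 (1 - p / (1 - p)),
    Finsupp.single 0 1]
  nonneg ω s := by
    obtain ⟨h0, h1⟩ := hp
    have h2 : 0 ≤ p / (1 - p) := div_nonneg (by linarith) (by linarith)
    have h3 : p / (1 - p) ≤ 1 := (div_le_one (by linarith)).2 (by linarith)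
    fin_cases ω
    · simp only [Fin.zero_eta, Matrix.cons_val_zero, Finsupp.add_apply, Finsupp.single_apply]
      split_ifs <;> linarith
    · simp only [Fin.mk_one, Matrix.cons_val_one, Matrix.cons_val_fin_one, Finsupp.single_apply]
      split_ifs <;> linarith
  sum_eq_one ω := by
    fin_cases ω
    · simp only [Fin.zero_eta, Matrix.cons_val_zero]
      rw [Finsupp.sum_add_index' (by simp) (by simp), Finsupp.sum_single_index rfl,
        Finsupp.sum_single_index rfl]
      ring
    · simp

/-- The pooled signal has posterior `1/2`, where `c` is strictly optimal as `ε > 0`, so ties are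
harmless. Its probability is `2 * p ≥ 1/5`. -/
theorem one_fifth_le_optimalUtility (R : BestResponse (Fin 2) (Fin 3)) (h0 : 0 < ε) :
    1 / 5 ≤ optimalUtility R (hardInstance ε p hε hp) := by
  refine le_trans ?_ (utility_le_optimalUtility R _ (poolingScheme p hp))
  obtain ⟨hp0, hp1⟩ := id hp
  have hp2 : (1 - p) * (p / (1 - p)) = p := mul_div_cancel₀ _ (by linarith)
  have hact : R.act (hardInstance ε p hε hp) (poolingScheme p hp) 0 = 2 := by
    have h := R.optimal (hardInstance ε p hε hp) (poolingScheme p hp) 0 2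
    generalize R.act (hardInstance ε p hε hp) (poolingScheme p hp) 0 = a at h
    rw [receiverValue_hardInstance, receiverValue_hardInstance] at h
    fin_cases a
    · simp [poolingScheme, hp2] at h
      nlinarith
    · simp [poolingScheme, hp2] at h
      nlinarith
    · rfl
  have h0 : ∀ π : Scheme (Fin 2), ∀ ω s, π.prob ω s *
      (hardInstance ε p hε hp).u (R.act (hardInstance ε p hε hp) π s) ω ≤
      (π.prob ω).sum fun s q => q * (hardInstance ε p hε hp).u
        (R.act (hardInstance ε p hε hp) π s) ω := by
    intro π ω s
    have hnn : ∀ s, 0 ≤ π.prob ω s *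
        (hardInstance ε p hε hp).u (R.act (hardInstance ε p hε hp) π s) ω := fun s =>
      mul_nonneg (π.nonneg ω s) ((hardInstance ε p hε hp).u_mem _ _).1
    by_cases hs : s ∈ (π.prob ω).support
    · exact single_le_sum (f := fun s => π.prob ω s *
        (hardInstance ε p hε hp).u (R.act (hardInstance ε p hε hp) π s) ω) (fun s _ => hnn s) hs
    · rw [Finsupp.notMem_support_iff.1 hs, zero_mul]
      exact sum_nonneg fun s _ => hnn s
  have hnonneg : 0 ≤ ((poolingScheme p hp).prob 0).sum fun s q => q *
      (hardInstance ε p hε hp).u (R.act (hardInstance ε p hε hp) (poolingScheme p hp) s) 0 :=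
    sum_nonneg fun s _ =>
      mul_nonneg ((poolingScheme p hp).nonneg 0 s) ((hardInstance ε p hε hp).u_mem _ _).1
  have e0 := mul_le_mul_of_nonneg_left (h0 (poolingScheme p hp) 0 0)
    (show (0 : ℝ) ≤ 1 - p by linarith)
  have e1 := mul_le_mul_of_nonneg_left (h0 (poolingScheme p hp) 1 0)
    (show (0 : ℝ) ≤ p by linarith)
  rw [hact] at e0 e1
  rw [utility, Fin.sum_univ_two]
  have q0 : (hardInstance ε p hε hp).prior 0 = 1 - p := rfl
  have q1 : (hardInstance ε p hε hp).prior 1 = p := rfl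
  rw [q0, q1]
  have v0 : (1 - p) * ((poolingScheme p hp).prob 0 0 * (hardInstance ε p hε hp).u 2 0) = p := by
    simp [poolingScheme, hardInstance, hp2]
  have v1 : p * ((poolingScheme p hp).prob 1 0 * (hardInstance ε p hε hp).u 2 1) = p := by
    simp [poolingScheme, hardInstance]
  linarith

theorem optimal_of_act_eq_two {R : BestResponse (Fin 2) (Fin 3)} {π : Scheme (Fin 2)} {s : ℕ}
    (h : R.act (hardInstance ε p hε hp) π s = 2) :
    (1 / 2 - ε) * ((1 - p) * π.prob 0 s) ≤ (1 / 2 + ε) * (p * π.prob 1 s) ∧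
      (1 / 2 - ε) * (p * π.prob 1 s) ≤ (1 / 2 + ε) * ((1 - p) * π.prob 0 s) := by
  have h0 := R.optimal (hardInstance ε p hε hp) π s 0
  have h1 := R.optimal (hardInstance ε p hε hp) π s 1
  rw [h, receiverValue_hardInstance, receiverValue_hardInstance] at h0 h1
  simp at h0 h1
  constructor <;> linarith

/-- At priors at distance at least `4 ε`, the receiver does not choose action `c` on the same
signal. -/
theorem prob_eq_zero_of_act_eq_two {R : BestResponse (Fin 2) (Fin 3)} {π : Scheme (Fin 2)} {s : ℕ}
    {p' : ℝ} (hp' : p' ∈ Set.Icc (1 / 10 : ℝ) (3 / 10)) (h0 : 0 < ε) (h1 : ε ≤ 1 / 20)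
    (hpp : p + 4 * ε ≤ p') (h : R.act (hardInstance ε p hε hp) π s = 2)
    (h' : R.act (hardInstance ε p' hε hp') π s = 2) (ω : Fin 2) : π.prob ω s = 0 := by
  obtain ⟨a1, a2⟩ := optimal_of_act_eq_two hε hp h
  obtain ⟨b1, b2⟩ := optimal_of_act_eq_two hε hp' h'
  obtain ⟨p0, p1⟩ := hp
  obtain ⟨q0, q1⟩ := hp'
  have hx := π.nonneg 0 s
  have hy := π.nonneg 1 s
  generalize hx' : π.prob 0 s = x at *
  generalize hy' : π.prob 1 s = y at *
  -- If `c` is chosen at both priors, their odds differ by a factor of at most `((1/2 + ε) / (1/2 -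
  -- ε)) ^ 2`. The separation exceeds this: `p' * (1 - p) - p * (1 - p') = p' - p ≥ 4 * ε`, while
  -- the two squares differ by only `2 * ε`.
  have key : (1 / 2 + ε) ^ 2 * (p * (1 - p')) < (1 / 2 - ε) ^ 2 * (p' * (1 - p)) := by
    have k1 : p * (1 - p') ≤ 27 / 100 := by nlinarith
    have k2 : (1 / 5 : ℝ) ≤ (1 / 2 - ε) ^ 2 := by nlinarith
    have k3 : p * (1 - p') + 4 * ε ≤ p' * (1 - p) := by linarith
    nlinarith [mul_le_mul_of_nonneg_left k3 (sq_nonneg (1 / 2 - ε)),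
      mul_le_mul_of_nonneg_left k1 h0.le, mul_le_mul_of_nonneg_left k2 h0.le]
  have c1 := mul_le_mul_of_nonneg_left b2
    (show 0 ≤ (1 / 2 - ε) * (1 - p) from mul_nonneg (by linarith) (by linarith))
  have c2 := mul_le_mul_of_nonneg_left a1
    (show 0 ≤ (1 / 2 + ε) * (1 - p') from mul_nonneg (by linarith) (by linarith))
  have y0 : y = 0 := by
    by_contra hne
    have hpos : 0 < y := lt_of_le_of_ne hy (Ne.symm hne)
    nlinarith [mul_lt_mul_of_pos_right key hpos]
  have x0 : x = 0 := by
    by_contra hne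
    have hpos : 0 < x := lt_of_le_of_ne hx (Ne.symm hne)
    have : 0 < (1 / 2 - ε) * ((1 - p) * x) :=
      mul_pos (by linarith) (mul_pos (by linarith) hpos)
    rw [y0] at a1
    linarith
  fin_cases ω
  · exact hx'.trans x0
  · exact hy'.trans y0

theorem conflicting_hardInstance {ι : Type*} [Fintype ι] (R : BestResponse (Fin 2) (Fin 3))
    (h0 : 0 < ε) (h1 : ε ≤ 1 / 20) (q : ι → ℝ) (hq : ∀ i, q i ∈ Set.Icc (1 / 10 : ℝ) (3 / 10))
    (hsep : ∀ i j, i ≠ j → q i + 4 * ε ≤ q j ∨ q j + 4 * ε ≤ q i) :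
    Conflicting R fun i => hardInstance ε (q i) hε (hq i) := by
  classical
  intro π ω s hs
  have hu : ∀ i, (hardInstance ε (q i) hε (hq i)).u
      (R.act (hardInstance ε (q i) hε (hq i)) π s) ω =
      if R.act (hardInstance ε (q i) hε (hq i)) π s = 2 then 1 else 0 := by
    intro i
    generalize R.act (hardInstance ε (q i) hε (hq i)) π s = a
    fin_cases a <;> simp [hardInstance]
  simp only [hu]
  rw [sum_boole]
  norm_cast
  refine card_le_one.2 fun i hi j hj => ?_
  by_contra hij
  simp only [mem_filter, mem_univ, true_and] at hi hj
  rcases hsep i j hij with h | h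
  · exact hs (prob_eq_zero_of_act_eq_two hε (hq i) (hq j) h0 h1 h hi hj ω)
  · exact hs (prob_eq_zero_of_act_eq_two hε (hq j) (hq i) h0 h1 h hj hi ω)

theorem le_sum_regret_hardInstance {N : ℕ} (R : BestResponse (Fin 2) (Fin 3))
    (alg : LearningAlgorithm (Fin 2) (Fin 3)) (h0 : 0 < ε) (h1 : ε ≤ 1 / 20) (q : Fin N → ℝ)
    (hq : ∀ i, q i ∈ Set.Icc (1 / 10 : ℝ) (3 / 10)) (hqi : ∀ i, q i = 1 / 10 + i * (4 * ε))
    {m T : ℕ} (hm : m ≤ T) :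
    N * (m * (1 / 5)) - 8 ^ m ≤ ∑ i, regret R (hardInstance ε (q i) hε (hq i)) alg T := by
  have hlt : ∀ i j : Fin N, i < j → q i + 4 * ε ≤ q j := by
    intro i j hij
    have : (i : ℝ) + 1 ≤ j := by exact_mod_cast hij
    rw [hqi, hqi]
    nlinarith
  have hc := conflicting_hardInstance hε R h0 h1 q hq fun i j hij =>
    (lt_or_gt_of_ne hij).imp (hlt i j) (hlt j i)
  have := hc.le_sum_regret alg hm fun i => one_fifth_le_optimalUtility hε (hq i) R h0
  norm_num at this ⊢
  exact this

end HardInstance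

/-! ### Choice of the family size and the number of counted periods. -/

theorem exists_le_regret (T : ℕ) (hT : 1 ≤ T) :
    ∃ (ε : ℝ) (hε : ε ∈ Set.Icc (0 : ℝ) (1 / 4)), 0 < ε ∧
      ∀ (R : BestResponse (Fin 2) (Fin 3)) (alg : LearningAlgorithm (Fin 2) (Fin 3)),
        ∃ (p : ℝ) (hp : p ∈ Set.Icc (1 / 10 : ℝ) (3 / 10)),
          1 / 10 * T ≤ regret R (hardInstance ε p hε hp) alg T := by
  have hN0 : (1 : ℝ) ≤ 8 ^ T := one_le_pow₀ (by norm_num)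
  have hN : ((10 * 8 ^ T : ℕ) : ℝ) = 10 * 8 ^ T := by push_cast; rfl
  -- This is the tolerance: `N = 10 * 8 ^ T` steps of length `4 * ε` fill an interval of length
  -- `1/5`. The error `8 ^ T` is `N / 10`, leaving an average of at least `T / 5 - 1 / 10 ≥ T / 10`.
  have he0 : 0 < 1 / (20 * ((10 * 8 ^ T : ℕ) : ℝ)) := by rw [hN]; positivity
  have he1 : 1 / (20 * ((10 * 8 ^ T : ℕ) : ℝ)) ≤ 1 / 20 := by
    rw [hN]; exact one_div_le_one_div_of_le (by norm_num) (by linarith)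
  have heN : 20 * ((10 * 8 ^ T : ℕ) : ℝ) * (1 / (20 * ((10 * 8 ^ T : ℕ) : ℝ))) = 1 :=
    mul_one_div_cancel (by rw [hN]; positivity)
  generalize 1 / (20 * ((10 * 8 ^ T : ℕ) : ℝ)) = ε at *
  generalize 10 * 8 ^ T = N at *
  have hε : ε ∈ Set.Icc (0 : ℝ) (1 / 4) := ⟨he0.le, by linarith⟩
  refine ⟨ε, hε, he0, fun R alg => ?_⟩
  have hq : ∀ i : Fin N, 1 / 10 + (i : ℝ) * (4 * ε) ∈ Set.Icc (1 / 10 : ℝ) (3 / 10) := by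
    intro i
    have hi : (i : ℝ) ≤ N := by exact_mod_cast i.2.le
    constructor <;> nlinarith [Nat.cast_nonneg (α := ℝ) (i : ℕ)]
  have hsum := le_sum_regret_hardInstance hε R alg he0 he1 _ hq (fun _ => rfl) (le_refl T)
  have hT1 : (1 : ℝ) ≤ T := by exact_mod_cast hT
  have hne : (univ : Finset (Fin N)).Nonempty := by
    have : 0 < N := by
      have : (0 : ℝ) < N := by linarith
      exact_mod_cast this
    exact ⟨⟨0, this⟩, mem_univ _⟩
  obtain ⟨i, -, hi⟩ := exists_le_of_sum_le (f := fun _ => 1 / 10 * (T : ℝ)) hne (le_trans (by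
    simp only [sum_const, card_univ, Fintype.card_fin, nsmul_eq_mul]
    nlinarith) hsum)
  exact ⟨_, hq i, hi⟩

theorem rpow_lt_gridSize_add_one (T : ℕ) :
    1 / 5 * (T : ℝ) ^ (3 / 2 : ℝ) < gridSize T + 1 := by
  have h := Nat.lt_floor_add_one ((1 / 5) / gridStep T)
  have e : gridStep T = ((T : ℝ) ^ (3 / 2 : ℝ))⁻¹ := Real.rpow_neg (Nat.cast_nonneg T) _
  rwa [← gridSize, e, div_inv_eq_mul] at h

theorem le_average_regret (T : ℕ) (hT : 10000 ≤ T) (R : BestResponse (Fin 2) (Fin 3))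
    (alg : LearningAlgorithm (Fin 2) (Fin 3)) :
    1 / 100 * Real.log T ≤
      (∑ i : Fin (gridSize T + 1), regret R (gridInstance T i) alg T) / (gridSize T + 1) := by
  have hT1 : (10000 : ℝ) ≤ T := by exact_mod_cast hT
  have hT0 : (0 : ℝ) < T := by linarith
  have hκ0 : 0 < gridStep T := Real.rpow_pos_of_pos hT0 _
  have hsize := rpow_lt_gridSize_add_one T
  have hsqrt : (T : ℝ) ^ (3 / 2 : ℝ) = T * √T := by
    rw [Real.sqrt_eq_rpow, ← Real.rpow_one_add' hT0.le (by norm_num)]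
    norm_num
  have hs : 100 ≤ √(T : ℝ) := Real.le_sqrt_of_sq_le (by linarith)
  rw [hsqrt] at hsize
  have hκ1 : gridStep T ≤ 1 / 5 := by
    rw [gridStep, Real.rpow_neg hT0.le, hsqrt]
    exact (inv_le_of_inv_le₀ (by norm_num) (by nlinarith))
  have hm : 8 ^ Nat.log 8 T ≤ T := Nat.pow_log_le_self 8 (by omega)
  have hm' : T < 8 ^ (Nat.log 8 T + 1) := Nat.lt_pow_succ_log_self (by norm_num) T
  have hmT : Nat.log 8 T ≤ T := Nat.log_le_self 8 T
  -- Only the first `m = ⌊log₈ T⌋` periods are counted, which keeps the error `8 ^ m` below `T`.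
  generalize Nat.log 8 T = m at *
  have hmR : (8 : ℝ) ^ m ≤ T := by exact_mod_cast hm
  have hlog8 : Real.log 8 ≤ 2.1 := by
    rw [show (8 : ℝ) = 2 ^ 3 by norm_num, Real.log_pow]
    have := Real.log_two_lt_d9
    norm_num at this ⊢
    linarith
  have hlog : Real.log T ≤ (m + 1) * 2.1 := by
    have h1 : Real.log T ≤ Real.log (8 ^ (m + 1)) :=
      Real.log_le_log hT0 (by exact_mod_cast hm'.le)
    rw [Real.log_pow, Nat.cast_add_one] at h1
    exact h1.trans (mul_le_mul_of_nonneg_left hlog8 (by positivity))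
  have hm4 : (4 : ℝ) ≤ m := by
    have : 4 ≤ m := by
      by_contra hlt
      have : 8 ^ (m + 1) ≤ 8 ^ 4 := Nat.pow_le_pow_right (by norm_num) (by omega)
      omega
    exact_mod_cast this
  have hsum := le_sum_regret_hardInstance (gridStep_div_mem T) R alg (by linarith)
    (by linarith) (gridPoint T) (gridPoint_mem T)
    (fun i => by rw [gridPoint, mul_div_cancel₀ _ (by norm_num)]) hmT
  rw [le_div_iff₀ (by positivity)]
  refine le_trans ?_ hsum
  push_cast
  -- As `√T ≥ 100`, the grid has more than `T * √T / 5 ≥ 20 * T` points, so the average regret is at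
  -- least `m / 5 - 1 / 20`.
  have h8 : (8 : ℝ) ^ m ≤ 1 / 20 * (gridSize T + 1) := by nlinarith
  nlinarith [Nat.cast_nonneg (α := ℝ) (gridSize T)]

end Persuasion

theorem theorem2 :
    ∃ c : ℝ, 0 < c ∧
      -- for every horizon and every learning algorithm there is an instance with regret at least
      -- `c * log T`; the utilities do not depend on the algorithm, which may know them
      (∀ T : ℕ, 1 ≤ T → ∃ (ε : ℝ) (hε : ε ∈ Set.Icc (0 : ℝ) (1 / 4)), 0 < ε ∧
        ∀ (R : Persuasion.BestResponse (Fin 2) (Fin 3))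
          (alg : Persuasion.LearningAlgorithm (Fin 2) (Fin 3)),
          ∃ (p : ℝ) (hp : p ∈ Set.Icc (1 / 10 : ℝ) (3 / 10)),
            c * Real.log T ≤ Persuasion.regret R (Persuasion.hardInstance ε p hε hp) alg T) ∧
      -- for all large horizons this already holds on average over the uniform distribution of the
      -- prior on the grid of step `T ^ (-3/2)`
      (∃ T₀ : ℕ, ∀ T : ℕ, T₀ ≤ T →
        ∀ (R : Persuasion.BestResponse (Fin 2) (Fin 3))
          (alg : Persuasion.LearningAlgorithm (Fin 2) (Fin 3)),
          c * Real.log T ≤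
            (∑ i : Fin (Persuasion.gridSize T + 1),
              Persuasion.regret R (Persuasion.gridInstance T i) alg T) /
                (Persuasion.gridSize T + 1)) := by
  refine ⟨1 / 100, by norm_num, fun T hT => ?_, 10000, Persuasion.le_average_regret⟩
  obtain ⟨ε, hε, h0, h⟩ := Persuasion.exists_le_regret T hT
  refine ⟨ε, hε, h0, fun R alg => ?_⟩
  obtain ⟨p, hp, hreg⟩ := h R alg
  refine ⟨p, hp, le_trans ?_ hreg⟩
  have hT1 : (1 : ℝ) ≤ T := by exact_mod_cast hT
  linarith [Real.log_le_self (Nat.cast_nonneg (α := ℝ) T)]
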